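/- Let $F$ be a non-archimedean local field with residue field of order $q$, $W_F$ its Weil group (formed inside $\mathrm{Gal}(F^{\mathrm{sep}}/F)$), and for $w\in W_F$ let $\|w\|=q^{d(w)}$, where $w$ acts on the residue field of $F^{\mathrm{sep}}$ as the $d(w)$-th power of the Frobenius automorphism $x\mapsto x^q$. For $s\in\mathbb C$ put $\omega_s(w)=\|w\|^s$. For $n\ge 1$, an L-homomorphism for $GL_n(F)$ is a homomorphism $\phi:SL_2(\mathbb C)\times W_F\to GL_n(\mathbb C)$ whose restriction to $SL_2(\mathbb C)$ is a rational morphism of complex algebraic groups and whose restriction $\varphi_2$ to $W_F$ is continuous with all values semisimple. An L-parameter $[\phi]$ of $GL_n(F)$ is a $GL_n(\mathbb C)$-conjugacy class of L-homomorphisms, and $\Phi(GL_n(F))$ is the set of L-parameters. The parameter $[\phi]$ is tempered if $\varphi_2(W_F)$ is relatively compact in $GL_n(\mathbb C)$. The twist $\phi\,\omega_s$ is $(A,w)\mapsto \phi(A,w)\cdot\|w\|^s$. **Theorem (Langlands classification of L-parameters for $GL_n(F)$).** For every $n\ge 1$ the L-parameters $[\phi]\in\Phi(GL_n(F))$ are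 in bijection with all tuples $$\mathcal T=(m_1,\dots,m_{s+1};\ [{}^t\phi^{(1)}],\dots,[{}^t\phi^{(s+1)}];\ \beta_1>\cdots>\beta_{s+1}),\qquad s\ge 0,$$ where the $m_i\ge 1$ are integers with $\sum_i m_i=n$, $[{}^t\phi^{(i)}]$ is a tempered L-parameter of $GL_{m_i}(F)$, and the $\beta_i$ are real numbers. The bijection sends $\mathcal T$ to the class $[\phi(\mathcal T)]$ of the block-diagonal L-homomorphism $$({}^t\phi^{(1)}\omega_{\beta_1},\ \dots,\ {}^t\phi^{(s+1)}\omega_{\beta_{s+1}}):\ SL_2(\mathbb C)\times W_F\to GL_{m_1}(\mathbb C)\times\cdots\times GL_{m_{s+1}}(\mathbb C)\subset GL_n(\mathbb C),$$ and this class does not depend on the choice of the representatives ${}^t\phi^{(i)}\in[{}^t\phi^{(i)}]$. -/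

import Mathlib

open scoped ValuativeRel MatrixGroups

noncomputable section

namespace LanglandsGL

/-! ### The Weil group of a non-archimedean local field -/

section WeilGroup

variable (F : Type*) [Field F] [ValuativeRel F] [TopologicalSpace F]
  [IsNonarchimedeanLocalField F]

/-- The order `q` of the residue field of `F`. -/
def residueCard : ℕ := Nat.card 𝓀[F]

/-- The ring of integers of the separable closure of `F`. -/
abbrev SepIntegers : Subalgebra 𝒪[F] (SeparableClosure F) :=
  integralClosure 𝒪[F] (SeparableClosure F)

/-- The maximal ideal of the ring of integers of the separable closure. As `𝒪[F]` is Henselian,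
that ring is local, so its maximal ideal is its Jacobson radical. -/
def sepMaximalIdeal : Ideal (SepIntegers F) := Ideal.jacobson ⊥

/-- The residue field of the separable closure of `F` (an algebraic closure of `𝓀[F]`). -/
abbrev SepResidue : Type _ := SepIntegers F ⧸ sepMaximalIdeal F

variable {F} in
/-- The action of an element of the absolute Galois group on the integers of the separable
closure. -/
def galAct (σ : Gal(SeparableClosure F/F)) : SepIntegers F ≃ₐ[𝒪[F]] SepIntegers F :=
  galRestrict 𝒪[F] F (SeparableClosure F) (SepIntegers F) σ

variable {F} in
/-- `σ` induces on the residue field of the separable closure the `d`-th power (`d ∈ ℤ`) of the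
Frobenius automorphism `Fr : x ↦ x ^ q`. Writing `d = a - b` with `a, b ≥ 0`, this says
`Fr ^ b ∘ σ = Fr ^ a`; as `Fr` is bijective, the choice of `a, b` does not matter. -/
def ActsAsFrobPow (σ : Gal(SeparableClosure F/F)) (d : ℤ) : Prop :=
  ∃ a b : ℕ, (a : ℤ) - b = d ∧ ∀ x : SepIntegers F,
    (Ideal.Quotient.mk (sepMaximalIdeal F) (galAct σ x)) ^ (residueCard F ^ b) =
      (Ideal.Quotient.mk (sepMaximalIdeal F) x) ^ (residueCard F ^ a)

/-- The Weil group `W_F`, as the fibre product of the absolute Galois group and `ℤ` over the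
Galois group of the residue field: the pairs `(σ, d)` such that `σ` acts on the residue field as
the `d`-th power of Frobenius. (The first projection identifies it with the group of those `σ`
that act as some integral power of Frobenius, and `d` is determined by `σ`.) -/
def weilSubgroup : Subgroup (Gal(SeparableClosure F/F) × Multiplicative ℤ) where
  carrier := {p | ActsAsFrobPow p.1 p.2.toAdd}
  one_mem' := ⟨0, 0, by simp, fun x => by simp [galAct]⟩
  mul_mem' := by
    rintro ⟨σ, d⟩ ⟨τ, e⟩ ⟨a, b, hab, h⟩ ⟨a', b', hab', h'⟩
    refine ⟨a + a', b + b', ?_, fun x => ?_⟩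
    · simp only [Prod.mk_mul_mk, toAdd_mul] at hab hab' ⊢
      push_cast
      omega
    · have e1 : galAct (σ * τ) x = galAct σ (galAct τ x) := by simp [galAct]
      simp only [Prod.mk_mul_mk] at h h' ⊢
      rw [e1, pow_add, pow_mul, h, ← pow_mul, mul_comm, pow_mul, h', ← pow_mul, ← pow_add,
        add_comm]
  inv_mem' := by
    rintro ⟨σ, d⟩ ⟨a, b, hab, h⟩
    refine ⟨b, a, ?_, fun x => ?_⟩
    · simp only [Prod.inv_mk, toAdd_inv] at hab ⊢
      omega
    · have e1 : galAct σ (galAct σ⁻¹ x) = x := by simp [galAct]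
      have := h (galAct σ⁻¹ x)
      simp only [Prod.inv_mk] at this ⊢
      rw [← this, e1]

/-- The Weil group `W_F`. Its topology is induced from the product of the Krull topology and the
discrete topology of `ℤ`; so the inertia group is open in it and carries its profinite topology. -/
abbrev WeilGroup : Type _ := weilSubgroup F

variable {F}

/-- The exponent `d(w)`: `w` acts on the residue field as the `d(w)`-th power of Frobenius. -/
def weilExponent (w : WeilGroup F) : ℤ := (w : Gal(SeparableClosure F/F) × Multiplicative ℤ).2.toAdd

/-- The absolute value `‖w‖ = q ^ d(w)`. -/
def weilNorm (w : WeilGroup F) : ℝ := (residueCard F : ℝ) ^ weilExponent w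

theorem residueCard_pos : 0 < residueCard F := by
  have : Finite 𝓀[F] := inferInstance
  exact Nat.card_pos

theorem weilNorm_pos (w : WeilGroup F) : 0 < weilNorm w :=
  zpow_pos (by exact_mod_cast residueCard_pos) _

theorem weilNorm_one : weilNorm (1 : WeilGroup F) = 1 := by
  simp [weilNorm, weilExponent]

theorem weilNorm_mul (v w : WeilGroup F) : weilNorm (v * w) = weilNorm v * weilNorm w := by
  have : (residueCard F : ℝ) ≠ 0 := by exact_mod_cast (residueCard_pos (F := F)).ne'
  simp [weilNorm, weilExponent, zpow_add₀ this]

theorem continuous_weilExponent : Continuous (weilExponent : WeilGroup F → ℤ) :=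
  continuous_toAdd.comp (continuous_snd.comp continuous_subtype_val)

/-- The unramified quasi-character `ω_s : w ↦ ‖w‖ ^ s`, for `s ∈ ℂ`. -/
def omega (s : ℂ) : WeilGroup F →* ℂˣ where
  toFun w := Units.mk0 ((weilNorm w : ℂ) ^ s)
    (by simp [Complex.cpow_eq_zero_iff, (weilNorm_pos w).ne'])
  map_one' := by ext; simp [weilNorm_one]
  map_mul' v w := by
    ext
    simp [weilNorm_mul, Complex.mul_cpow_ofReal_nonneg (weilNorm_pos v).le (weilNorm_pos w).le]

theorem continuous_omega (s : ℂ) : Continuous fun w : WeilGroup F => (omega s w : ℂ) := by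
  have : (fun w : WeilGroup F => (omega s w : ℂ)) =
      (fun d : ℤ => (((residueCard F : ℝ) ^ d : ℝ) : ℂ) ^ s) ∘ weilExponent := rfl
  rw [this]
  exact continuous_of_discreteTopology.comp continuous_weilExponent

end WeilGroup

/-! ### Facts on matrices -/

section Matrices

variable {n : ℕ}

/-- A homomorphism `SL₂(ℂ) → GLₙ(ℂ)` is rational if it is a morphism of algebraic groups: its
matrix entries are polynomials in the entries of the argument. (The entries of the inverse are
then polynomials as well.) -/
def IsRationalHom (f : SL(2, ℂ) →* GL (Fin n) ℂ) : Prop :=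
  ∀ i j, ∃ P : MvPolynomial (Fin 2 × Fin 2) ℂ, ∀ A : SL(2, ℂ),
    (f A : Matrix (Fin n) (Fin n) ℂ) i j = MvPolynomial.eval (fun k => A k.1 k.2) P

/-- An element of `GLₙ(ℂ)` is semisimple if it is so as an endomorphism of `ℂⁿ`. -/
def IsSemisimpleGL (g : GL (Fin n) ℂ) : Prop :=
  Module.End.IsSemisimple (Matrix.toLin' (g : Matrix (Fin n) (Fin n) ℂ))

theorem isSemisimple_iff_exists {m : Type*} [Fintype m] [DecidableEq m] (M : Matrix m m ℂ) :
    Module.End.IsSemisimple (Matrix.toLin' M) ↔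
      ∃ p : Polynomial ℂ, Squarefree p ∧ Polynomial.aeval M p = 0 := by
  have key (p : Polynomial ℂ) :
      Polynomial.aeval (Matrix.toLin' M) p = Matrix.toLin' (Polynomial.aeval M p) :=
    Polynomial.aeval_algHom_apply (Matrix.toLinAlgEquiv' (R := ℂ) (n := m)) M p
  constructor
  · intro h
    refine ⟨minpoly ℂ (Matrix.toLin' M), h.minpoly_squarefree, ?_⟩
    have := minpoly.aeval ℂ (Matrix.toLin' M)
    rw [key] at this
    exact (Matrix.toLin' (R := ℂ) (n := m)).map_eq_zero_iff.1 this
  · rintro ⟨p, hp, h⟩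
    exact Module.End.isSemisimple_of_squarefree_aeval_eq_zero hp (by rw [key, h, map_zero])

theorem IsSemisimpleGL.smul {g : GL (Fin n) ℂ} (h : IsSemisimpleGL g) (c : ℂˣ) :
    IsSemisimpleGL (c • g) := by
  have h1 := Module.End.IsSemisimple.aeval h (Polynomial.C (c : ℂ) * Polynomial.X)
  have h2 : Matrix.toLin' ((c • g : GL (Fin n) ℂ) : Matrix (Fin n) (Fin n) ℂ) =
      (c : ℂ) • Matrix.toLin' (g : Matrix (Fin n) (Fin n) ℂ) := by
    rw [← map_smul]
    rfl
  rw [map_mul, Polynomial.aeval_C, Polynomial.aeval_X, ← Algebra.smul_def] at h1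
  rw [IsSemisimpleGL, h2]
  exact h1

/-- The block-diagonal embedding `∏ GL_{mᵢ}(ℂ) → GLₙ(ℂ)`, `n = ∑ mᵢ`, blocks in the given order. -/
def blockDiag {k : ℕ} (m : Fin k → ℕ) (hm : ∑ i, m i = n) :
    (∀ i, GL (Fin (m i)) ℂ) →* GL (Fin n) ℂ :=
  (Units.map
    ((Matrix.reindexAlgEquiv ℂ ℂ (finSigmaFinEquiv.trans (finCongr hm)) :
        Matrix ((i : Fin k) × Fin (m i)) ((i : Fin k) × Fin (m i)) ℂ →*
          Matrix (Fin n) (Fin n) ℂ).comp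
      (Matrix.blockDiagonal'RingHom (fun i => Fin (m i)) ℂ).toMonoidHom)).comp
    (MulEquiv.piUnits (M := fun i => Matrix (Fin (m i)) (Fin (m i)) ℂ)).symm.toMonoidHom

theorem coe_blockDiag {k : ℕ} (m : Fin k → ℕ) (hm : ∑ i, m i = n)
    (g : ∀ i, GL (Fin (m i)) ℂ) :
    (blockDiag m hm g : Matrix (Fin n) (Fin n) ℂ) =
      Matrix.reindexAlgEquiv ℂ ℂ (finSigmaFinEquiv.trans (finCongr hm))
        (Matrix.blockDiagonal' fun i => (g i : Matrix (Fin (m i)) (Fin (m i)) ℂ)) := rfl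

theorem continuous_blockDiag {k : ℕ} (m : Fin k → ℕ) (hm : ∑ i, m i = n) :
    Continuous (blockDiag m hm) := by
  have h1 : Continuous fun g : ∀ i, GL (Fin (m i)) ℂ =>
      (blockDiag m hm g : Matrix (Fin n) (Fin n) ℂ) := by
    simp only [coe_blockDiag, Matrix.coe_reindexAlgEquiv, Matrix.reindex_apply]
    exact (Continuous.matrix_blockDiagonal' (continuous_pi fun i =>
      Units.continuous_val.comp (continuous_apply i))).matrix_submatrix _ _
  refine Units.continuous_iff.2 ⟨h1, ?_⟩
  have : (fun g => ((blockDiag m hm g)⁻¹ : GL (Fin n) ℂ).val) =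
      (fun g => (blockDiag m hm g : Matrix (Fin n) (Fin n) ℂ)) ∘ fun g => g⁻¹ := by
    funext g
    simp [← map_inv]
  exact this ▸ h1.comp continuous_inv

theorem isSemisimpleGL_blockDiag {k : ℕ} (m : Fin k → ℕ) (hm : ∑ i, m i = n)
    {g : ∀ i, GL (Fin (m i)) ℂ} (h : ∀ i, IsSemisimpleGL (g i)) :
    IsSemisimpleGL (blockDiag m hm g) := by
  choose p hp hp0 using fun i => (isSemisimple_iff_exists _).1 (h i)
  have hne : (∏ i, p i) ≠ 0 := Finset.prod_ne_zero_iff.2 fun i _ => (hp i).ne_zero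
  have hq (i) : p i ∣ UniqueFactorizationMonoid.radical (∏ i, p i) :=
    (UniqueFactorizationMonoid.dvd_radical_iff (hp i).isRadical hne).2
      (Finset.dvd_prod_of_mem _ (Finset.mem_univ i))
  refine (isSemisimple_iff_exists _).2
    ⟨_, UniqueFactorizationMonoid.squarefree_radical (a := ∏ i, p i), ?_⟩
  generalize UniqueFactorizationMonoid.radical (∏ i, p i) = r at hq
  have hr (i) : Polynomial.aeval (g i : Matrix (Fin (m i)) (Fin (m i)) ℂ) r = 0 := by
    obtain ⟨c, hc⟩ := hq i
    rw [hc, map_mul, hp0, zero_mul]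
  rw [coe_blockDiag]
  erw [Polynomial.aeval_algHom_apply
    (Matrix.reindexAlgEquiv ℂ ℂ (finSigmaFinEquiv.trans (finCongr hm)))]
  let B : (∀ i, Matrix (Fin (m i)) (Fin (m i)) ℂ) →ₐ[ℂ]
      Matrix ((i : Fin k) × Fin (m i)) ((i : Fin k) × Fin (m i)) ℂ :=
    AlgHom.ofLinearMap
      { toFun := fun M => Matrix.blockDiagonal' M
        map_add' := Matrix.blockDiagonal'_add
        map_smul' := fun c M => Matrix.blockDiagonal'_smul c M }
      Matrix.blockDiagonal'_one Matrix.blockDiagonal'_mul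
  have hB : Polynomial.aeval (Matrix.blockDiagonal'
      fun i => (g i : Matrix (Fin (m i)) (Fin (m i)) ℂ)) r = 0 := by
    have h0 : Polynomial.aeval
        (fun i => (g i : Matrix (Fin (m i)) (Fin (m i)) ℂ)) r = 0 := by
      funext i
      rw [Polynomial.aeval_pi_apply]
      exact hr i
    exact (Polynomial.aeval_algHom_apply B _ r).trans (by rw [h0, map_zero])
  rw [hB, map_zero]

end Matrices

/-! ### L-parameters of `GLₙ(F)` -/

section Parameters

variable (F : Type*) [Field F] [ValuativeRel F] [TopologicalSpace F]
  [IsNonarchimedeanLocalField F]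

/-- An L-homomorphism for `GLₙ(F)`: a homomorphism `SL₂(ℂ) × W_F → GLₙ(ℂ)` which is rational on
`SL₂(ℂ)`, and continuous with semisimple values on `W_F`. (The Galois action on the dual group
`GLₙ(ℂ)` is trivial, so homomorphisms over `W_F` into the L-group `GLₙ(ℂ) × W_F` are given by
their first component.) -/
structure LHom (n : ℕ) where
  /-- the underlying homomorphism -/
  toHom : SL(2, ℂ) × WeilGroup F →* GL (Fin n) ℂ
  rational : IsRationalHom (toHom.comp (MonoidHom.inl _ _))
  continuous : Continuous (toHom.comp (MonoidHom.inr SL(2, ℂ) (WeilGroup F)))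
  semisimple : ∀ w, IsSemisimpleGL (toHom.comp (MonoidHom.inr SL(2, ℂ) (WeilGroup F)) w)

/-- L-homomorphisms are equivalent if they are conjugate under `GLₙ(ℂ)`. -/
instance LHom.setoid (n : ℕ) : Setoid (LHom F n) where
  r φ ψ := ∃ g : GL (Fin n) ℂ, ∀ x, ψ.toHom x = g * φ.toHom x * g⁻¹
  iseqv :=
    { refl := fun φ => ⟨1, fun x => by simp⟩
      symm := fun {φ ψ} ⟨g, hg⟩ => ⟨g⁻¹, fun x => by simp [hg, mul_assoc]⟩
      trans := fun {φ ψ χ} ⟨g, hg⟩ ⟨h, hh⟩ =>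
        ⟨h * g, fun x => by simp [hg, hh, mul_assoc]⟩ }

/-- The set `Φ(GLₙ(F))` of L-parameters. -/
def LParameter (n : ℕ) : Type _ := Quotient (LHom.setoid F n)

variable {F}

/-- The L-parameter `[φ]`. -/
def LHom.toLParameter {n : ℕ} (φ : LHom F n) : LParameter F n := Quotient.mk _ φ

/-- The image of `W_F` is relatively compact in `GLₙ(ℂ)`. -/
def LHom.IsTempered {n : ℕ} (φ : LHom F n) : Prop :=
  IsCompact (closure (Set.range (φ.toHom.comp (MonoidHom.inr SL(2, ℂ) (WeilGroup F)))))

theorem LHom.IsTempered.of_equiv {n : ℕ} {φ ψ : LHom F n} (h : φ ≈ ψ) (hφ : φ.IsTempered) :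
    ψ.IsTempered := by
  obtain ⟨g, hg⟩ := h
  have hc : Continuous fun y : GL (Fin n) ℂ => g * y * g⁻¹ := by fun_prop
  refine (hφ.image hc).of_isClosed_subset isClosed_closure ?_
  refine closure_minimal ?_ (hφ.image hc).isClosed
  rintro _ ⟨w, rfl⟩
  exact ⟨_, subset_closure ⟨w, rfl⟩, (hg _).symm⟩

/-- An L-parameter is tempered if its representatives are. -/
def LParameter.IsTempered {n : ℕ} (c : LParameter F n) : Prop :=
  Quotient.lift LHom.IsTempered
    (fun _ _ h => propext ⟨fun a => a.of_equiv h, fun a => a.of_equiv (Setoid.symm h)⟩) c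

/-- The twist `φ ω_s`: `(A, w) ↦ ‖w‖ ^ s φ(A, w)`. -/
def LHom.twist {n : ℕ} (φ : LHom F n) (s : ℂ) : LHom F n where
  toHom :=
    { toFun := fun x => omega s x.2 • φ.toHom x
      map_one' := by simp
      map_mul' := fun x y => by
        ext : 1
        simp [Units.smul_def, smul_smul, mul_comm] }
  rational := by
    intro i j
    obtain ⟨P, hP⟩ := φ.rational i j
    exact ⟨P, fun A => by simpa using hP A⟩
  continuous := by
    have h := Units.continuous_iff.1 φ.continuous
    have ho := continuous_omega (F := F) s
    have ho' : Continuous fun w : WeilGroup F => ((omega s w)⁻¹ : ℂˣ).val := by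
      simpa [Pi.inv_def] using ho.inv₀ fun w => (omega s w).ne_zero
    refine Units.continuous_iff.2 ⟨?_, ?_⟩
    · exact ho.smul h.1
    · refine (ho'.smul h.2).congr fun w => ?_
      rfl
  semisimple := fun w => (φ.semisimple w).smul _

/-- The block-diagonal L-homomorphism `(φ₁, …, φ_k)` of `GLₙ(F)`, `n = ∑ mᵢ`. -/
def LHom.block {n k : ℕ} (m : Fin k → ℕ) (hm : ∑ i, m i = n) (φ : ∀ i, LHom F (m i)) :
    LHom F n where
  toHom := (blockDiag m hm).comp (MonoidHom.pi fun i => (φ i).toHom)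
  rational := by
    intro i j
    choose P hP using fun i => (φ i).rational
    let e := (finSigmaFinEquiv.trans (finCongr hm)).symm
    by_cases h : (e i).1 = (e j).1
    · refine ⟨P _ (e i).2 (cast (by rw [h]) (e j).2), fun A => ?_⟩
      rw [← hP]
      simp only [MonoidHom.comp_apply, coe_blockDiag, Matrix.coe_reindexAlgEquiv,
        Matrix.reindex_apply, Matrix.submatrix_apply, Matrix.blockDiagonal'_apply]
      exact dif_pos h
    · refine ⟨0, fun A => ?_⟩
      simp only [MonoidHom.comp_apply, coe_blockDiag, Matrix.coe_reindexAlgEquiv,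
        Matrix.reindex_apply, Matrix.submatrix_apply, Matrix.blockDiagonal'_apply, map_zero]
      exact dif_neg h
  continuous := (continuous_blockDiag m hm).comp (continuous_pi fun i => (φ i).continuous)
  semisimple := fun w => isSemisimpleGL_blockDiag m hm fun i => (φ i).semisimple w

variable (F)

/-- The tuples `(m₁, …, m_{s+1}; [φ₁], …, [φ_{s+1}]; β₁ > ⋯ > β_{s+1})` with `mᵢ ≥ 1`,
`∑ mᵢ = n`, and `[φᵢ]` a tempered L-parameter of `GL_{mᵢ}(F)`. -/
structure StandardTuple (n : ℕ) where
  /-- the number of blocks minus one -/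
  s : ℕ
  /-- the block sizes -/
  m : Fin (s + 1) → ℕ
  one_le_m : ∀ i, 1 ≤ m i
  sum_m : ∑ i, m i = n
  /-- the tempered L-parameters -/
  param : ∀ i, LParameter F (m i)
  tempered : ∀ i, (param i).IsTempered
  /-- the real exponents -/
  β : Fin (s + 1) → ℝ
  β_anti : StrictAnti β

end Parameters

end LanglandsGL

end

/-!
The theorem rests on a grading of L-homomorphisms by growth. Let `q` be the order of the residue
field, `w₀ ∈ W_F` a Frobenius element, and `I` the inertia group, so that `W_F` is the product of
`I` and the powers of `w₀`. Two facts on `F` are used: `w₀` exists (`exists_weilExponent_eq_one`),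
and `I` is compact (`isCompact_setOf_weilExponent_eq_zero`). The first needs that the ring of
integers of the separable closure is local (`isLocalRing_sepIntegers`), which holds because that
ring is the unit ball of the multiplicative spectral norm.

Surjectivity. Given `φ`, the semisimple matrix `φ(w₀)` has an eigenbasis with eigenvalues `λ i`; put
`b i = log_q |λ i|`. The elements of `SL₂(ℂ)` commute with `w₀`, so they preserve its eigenspaces.
For `w ∈ I`, the entries `(λ i / λ j) ^ k φ(w) i j` of `φ(w₀ ^ k w w₀ ^ (-k))` are bounded in
`k ∈ ℤ` by compactness of `I`, whence `φ(w) i j = 0` unless `|λ i| = |λ j|`. So all of `φ` is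
block-diagonal with respect to the values of `b`, and on the block of value `β` the matrix `φ(w)` is
`O(‖w‖ ^ β)` (`LHom.exists_graded`). Twisting by `ω_{-β}` therefore makes the block bounded on
`W_F`, which is to say tempered (`LHom.isTempered_iff`); see `exists_block_equiv`.

Injectivity. If `H` intertwines `φ ω_β` and `φ' ω_β'` with `φ`, `φ'` tempered, then
`‖w‖ ^ (β - β') H = φ'(w) H φ(w)⁻¹` is bounded, and since `‖w‖` takes the values `q ^ k`, `k ∈ ℤ`,
either `β = β'` or `H = 0` (`eq_zero_of_intertwines`). Hence a matrix that conjugates the images of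
two tuples is block-diagonal with invertible blocks, one for each common exponent, and the tuples
agree (`StandardTuple.eq_of_block_equiv`).
-/

noncomputable section

namespace LanglandsGL

/-! ### The ring of integers of the separable closure, Frobenius elements and inertia -/

/-- The integral closure of the unit ball of a complete nonarchimedean field `K` in an algebraic
extension `L` is the unit ball of the spectral norm of `L`. As that norm is multiplicative, the
elements of norm `1` are units, and `y` or `1 - y` has norm `1`. -/
theorem isLocalRing_integralClosure_of_norm {A K L : Type*} [CommRing A] [IsDomain A]
    [IsIntegrallyClosed A] [NontriviallyNormedField K] [IsUltrametricDist K] [CompleteSpace K]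
    [Algebra A K] [IsFractionRing A K] [Field L] [Algebra K L] [Algebra.IsAlgebraic K L]
    [Algebra A L] [IsScalarTower A K L]
    (hA : ∀ x : K, ‖x‖ ≤ 1 ↔ x ∈ (algebraMap A K).range) :
    IsLocalRing (integralClosure A L) := by
  let N := spectralMulAlgNorm K L
  have key (y : L) : N y ≤ 1 ↔ IsIntegral A y := by
    have hy : IsIntegral K y := Algebra.IsIntegral.isIntegral y
    rw [show N y = spectralValue (minpoly K y) from rfl,
      spectralValue_le_one_iff (minpoly.monic hy)]
    constructor
    · intro h
      have hl : minpoly K y ∈ Polynomial.lifts (algebraMap A K) :=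
        (Polynomial.lifts_iff_coeff_lifts _).2 fun n => (hA _).1 (h n)
      obtain ⟨p, hp, -, hm⟩ := Polynomial.lifts_and_natDegree_eq_and_monic hl (minpoly.monic hy)
      refine ⟨p, hm, ?_⟩
      have := minpoly.aeval K y
      rwa [← hp, Polynomial.aeval_map_algebraMap] at this
    · intro h n
      rw [minpoly.isIntegrallyClosed_eq_field_fractions' K h, Polynomial.coeff_map]
      exact (hA _).2 ⟨_, rfl⟩
  have unit (y : integralClosure A L) (hy : N y = 1) : IsUnit y := by
    have h0 : (y : L) ≠ 0 := by
      intro h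
      rw [h, map_zero] at hy
      exact zero_ne_one hy
    have hi : N (y : L)⁻¹ = 1 := by
      have := map_mul N (y : L) (y : L)⁻¹
      rwa [mul_inv_cancel₀ h0, map_one, hy, one_mul, eq_comm] at this
    exact IsUnit.of_mul_eq_one ⟨(y : L)⁻¹, (key _).1 hi.le⟩ (Subtype.ext (mul_inv_cancel₀ h0))
  refine IsLocalRing.of_isUnit_or_isUnit_one_sub_self fun y => ?_
  by_cases hy : N y = 1
  · exact Or.inl (unit y hy)
  · refine Or.inr (unit _ ?_)
    have h1 : N (y : L) < 1 := lt_of_le_of_ne ((key _).2 y.2) hy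
    refine le_antisymm ((key _).2 (1 - y).2) ?_
    by_contra! h2
    have h3 : N ((1 - y : L) + y) ≤ max (N (1 - y : L)) (N y) :=
      isNonarchimedean_spectralNorm (K := K) (L := L) _ _
    rw [sub_add_cancel, map_one] at h3
    exact absurd h3 (not_le.2 (max_lt h2 h1))

theorem isLocalRing_integralClosure_of_valued {A K L Γ₀ : Type*} [CommRing A] [IsDomain A]
    [IsIntegrallyClosed A] [Field K] [LinearOrderedCommGroupWithZero Γ₀] [hv : Valued K Γ₀]
    [hv.v.RankOne] [CompleteSpace K] [Algebra A K] [IsFractionRing A K] [Field L] [Algebra K L]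
    [Algebra.IsAlgebraic K L] [Algebra A L] [IsScalarTower A K L]
    (hA : ∀ x : K, hv.v x ≤ 1 ↔ x ∈ (algebraMap A K).range) :
    IsLocalRing (integralClosure A L) := by
  let := Valued.toNontriviallyNormedField (L := K)
  exact isLocalRing_integralClosure_of_norm (K := K) fun x => by
    rw [Valued.toNormedField.norm_le_one_iff, hA]

section GaloisAction

variable (F : Type*) [Field F] [ValuativeRel F]

theorem galAct_coe (σ : Gal(SeparableClosure F/F)) (x : SepIntegers F) :
    (galAct σ x : SeparableClosure F) = σ x :=
  algebraMap_galRestrict_apply 𝒪[F] σ x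

theorem mem_range_algebraMap_of_galAct_eq {x : SepIntegers F} (hx : ∀ σ, galAct σ x = x) :
    ∃ a, algebraMap 𝒪[F] (SepIntegers F) a = x := by
  have hfix : ∀ σ : Gal(SeparableClosure F/F), σ x = x := fun σ => by
    conv_rhs => rw [← hx σ]
    exact (algebraMap_galRestrict_apply 𝒪[F] σ x).symm
  have hb : (x : SeparableClosure F) ∈ (⊥ : IntermediateField F (SeparableClosure F)) :=
    (InfiniteGalois.mem_bot_iff_fixed _).2 hfix
  obtain ⟨k, hk⟩ := IntermediateField.mem_bot.1 hb
  have hi : IsIntegral 𝒪[F] (algebraMap F (SeparableClosure F) k) := hk ▸ x.2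
  rw [isIntegral_algebraMap_iff (FaithfulSMul.algebraMap_injective F _)] at hi
  obtain ⟨a, rfl⟩ := IsIntegrallyClosed.algebraMap_eq_of_integral hi
  exact ⟨a, Subtype.ext hk⟩

/-- The stabilizer of an algebraic element is open in the Krull topology. -/
theorem isLocallyConstant_galAct (x : SepIntegers F) :
    IsLocallyConstant fun σ : Gal(SeparableClosure F/F) => galAct σ x := by
  refine IsLocallyConstant.iff_eventually_eq _ |>.2 fun σ => ?_
  have hc : Continuous fun τ : Gal(SeparableClosure F/F) => σ⁻¹ * τ := by fun_prop
  have h := (stabilizer_isOpen_of_isIntegral (K := F) (x : SeparableClosure F)).preimage hc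
  refine Filter.mem_of_superset (h.mem_nhds (by simp)) fun τ hτ => Subtype.ext ?_
  have h1 : (σ⁻¹ * τ) • (x : SeparableClosure F) = x := hτ
  rw [mul_smul, inv_smul_eq_iff] at h1
  rw [galAct_coe, galAct_coe]
  exact h1

end GaloisAction

section WeilGroup

variable (F : Type*) [Field F] [ValuativeRel F] [TopologicalSpace F]
  [IsNonarchimedeanLocalField F]

instance isLocalRing_sepIntegers : IsLocalRing (SepIntegers F) := by
  let := IsTopologicalAddGroup.rightUniformSpace F
  have := isUniformAddGroup_of_addCommGroup (G := F)
  let : (Valued.v (R := F)).RankOne :=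
  { hom' := ValuativeRel.IsRankLeOne.nonempty.some.emb (R := F).comp
      MonoidWithZeroHom.ValueGroup₀.embedding
    strictMono' := ValuativeRel.IsRankLeOne.nonempty.some.strictMono.comp
        MonoidWithZeroHom.ValueGroup₀.embedding_strictMono }
  refine isLocalRing_integralClosure_of_valued (K := F) fun x => ?_
  constructor
  · intro h
    exact ⟨⟨x, h⟩, rfl⟩
  · rintro ⟨y, rfl⟩
    exact y.2

theorem sepMaximalIdeal_eq : sepMaximalIdeal F = IsLocalRing.maximalIdeal (SepIntegers F) :=
  IsLocalRing.jacobson_eq_maximalIdeal ⊥ bot_ne_top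

instance isMaximal_sepMaximalIdeal : (sepMaximalIdeal F).IsMaximal := by
  rw [sepMaximalIdeal_eq]
  infer_instance

instance liesOver_sepMaximalIdeal : (sepMaximalIdeal F).LiesOver 𝓂[F] :=
  ⟨(IsLocalRing.eq_maximalIdeal (Ideal.isMaximal_comap_of_isIntegral_of_isMaximal _)).symm⟩

attribute [local instance] Ideal.Quotient.field in
/-- A Frobenius element exists: the stabilizer of the maximal ideal in the Galois group surjects
onto the Galois group of the residue field extension. -/
theorem exists_actsAsFrobPow_one : ∃ σ : Gal(SeparableClosure F/F), ActsAsFrobPow σ 1 := by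
  let _ : MulSemiringAction Gal(SeparableClosure F/F) (SepIntegers F) :=
    IsIntegralClosure.MulSemiringAction 𝒪[F] F (SeparableClosure F) (SepIntegers F)
  -- The action on the integers is continuous for their discrete topology.
  let _ : TopologicalSpace (SepIntegers F) := ⊥
  have : DiscreteTopology (SepIntegers F) := ⟨rfl⟩
  have : ContinuousSMul Gal(SeparableClosure F/F) (SepIntegers F) := by
    refine (continuousSMul_iff_stabilizer_isOpen (M := Gal(SeparableClosure F/F))
      (X := SepIntegers F)).2 fun x => ?_
    exact (isLocallyConstant_galAct F x).isOpen_fiber x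
  have : SMulCommClass Gal(SeparableClosure F/F) 𝒪[F] (SepIntegers F) :=
    ⟨fun σ a x => map_smul (galAct σ) a x⟩
  have : Algebra.IsInvariant 𝒪[F] (SepIntegers F) Gal(SeparableClosure F/F) :=
    ⟨fun x hx => mem_range_algebraMap_of_galAct_eq F hx⟩
  have hq : Finite (𝒪[F] ⧸ 𝓂[F]) := inferInstanceAs (Finite 𝓀[F])
  let _ := Fintype.ofFinite (𝒪[F] ⧸ 𝓂[F])
  have : Algebra.IsIntegral (𝒪[F] ⧸ 𝓂[F]) (SepResidue F) :=
    Ideal.Quotient.algebra_isIntegral_of_liesOver (sepMaximalIdeal F) 𝓂[F]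
  have : Algebra.IsAlgebraic (𝒪[F] ⧸ 𝓂[F]) (SepResidue F) :=
    Algebra.IsIntegral.isAlgebraic
  obtain ⟨⟨σ, hσ⟩, h⟩ := Ideal.Quotient.stabilizerHom_surjective_of_profinite
    (G := Gal(SeparableClosure F/F)) 𝓂[F] (sepMaximalIdeal F)
    (FiniteField.frobeniusAlgEquivOfAlgebraic (𝒪[F] ⧸ 𝓂[F]) (SepResidue F))
  refine ⟨σ, 1, 0, rfl, fun x => ?_⟩
  have h2 := DFunLike.congr_fun h (Ideal.Quotient.mk _ x)
  rw [pow_zero, pow_one, pow_one]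
  refine h2.trans ?_
  rw [FiniteField.coe_frobeniusAlgEquivOfAlgebraic, residueCard, ← Nat.card_eq_fintype_card]
  rfl

theorem exists_weilExponent_eq_one : ∃ w : WeilGroup F, weilExponent w = 1 := by
  obtain ⟨σ, hσ⟩ := exists_actsAsFrobPow_one F
  exact ⟨⟨(σ, Multiplicative.ofAdd 1), hσ⟩, rfl⟩

theorem one_lt_residueCard : 1 < residueCard F :=
  Finite.one_lt_card

attribute [local instance] Ideal.Quotient.field in
theorem actsAsFrobPow_zero_iff (σ : Gal(SeparableClosure F/F)) :
    ActsAsFrobPow σ 0 ↔ ∀ x : SepIntegers F,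
      Ideal.Quotient.mk (sepMaximalIdeal F) (galAct σ x) = Ideal.Quotient.mk _ x := by
  constructor
  · rintro ⟨a, b, hab, h⟩ x
    obtain rfl : a = b := by omega
    -- Frobenius is injective on the residue field, so the power `q ^ a` on both sides cancels.
    have hinj : Function.Injective fun y : SepResidue F => y ^ residueCard F ^ a := by
      have : Finite (𝒪[F] ⧸ 𝓂[F]) := inferInstanceAs (Finite 𝓀[F])
      let _ := Fintype.ofFinite (𝒪[F] ⧸ 𝓂[F])
      have h0 : Function.Injective (FiniteField.frobeniusAlgHom (𝒪[F] ⧸ 𝓂[F]) (SepResidue F)) :=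
        RingHom.injective _
      have h1 := h0.iterate a
      rw [FiniteField.coe_frobeniusAlgHom, pow_iterate, ← Nat.card_eq_fintype_card] at h1
      exact h1
    exact hinj (h x)
  · exact fun h => ⟨0, 0, rfl, fun x => by rw [h]⟩

/-- The inertia group is compact, as it is closed in the profinite group `Gal(Fˢᵉᵖ/F)`. -/
theorem isCompact_setOf_weilExponent_eq_zero :
    IsCompact {w : WeilGroup F | weilExponent w = 0} := by
  let S : Set Gal(SeparableClosure F/F) := {σ | ActsAsFrobPow σ 0}
  have hS : IsClosed S := by
    have : S = ⋂ x : SepIntegers F, {σ | Ideal.Quotient.mk (sepMaximalIdeal F) (galAct σ x) =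
        Ideal.Quotient.mk _ x} := by
      ext σ
      simp [S, actsAsFrobPow_zero_iff]
    rw [this]
    exact isClosed_iInter fun x =>
      ((isLocallyConstant_galAct F x).comp
        (Ideal.Quotient.mk (sepMaximalIdeal F))).isClosed_fiber _
  rw [(Topology.IsEmbedding.subtypeVal (p := (· ∈ weilSubgroup F))).isInducing.isCompact_iff]
  convert hS.isCompact.prod (isCompact_singleton (x := (1 : Multiplicative ℤ))) using 1
  ext ⟨σ, d⟩
  constructor
  · rintro ⟨⟨p, h⟩, h0, rfl⟩
    obtain rfl : d = 1 := h0
    exact ⟨h, rfl⟩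
  · rintro ⟨h, rfl⟩
    exact ⟨⟨(σ, 1), h⟩, rfl, rfl⟩

end WeilGroup

/-! ### Block matrices -/

section SigmaBlock

variable {I J K R : Type*} {a : I → Type*} {b : J → Type*} {c : K → Type*}

/-- The `(i, j)` block of a matrix whose rows and columns are indexed by sigma types. -/
def sigmaBlock (G : Matrix (Σ i, a i) (Σ j, b j) R) (i : I) (j : J) : Matrix (a i) (b j) R :=
  G.submatrix (Sigma.mk i) (Sigma.mk j)

theorem sigmaBlock_mul [NonUnitalNonAssocSemiring R] [Fintype J] [∀ j, Fintype (b j)]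
    (G : Matrix (Σ i, a i) (Σ j, b j) R) (H : Matrix (Σ j, b j) (Σ k, c k) R) (i : I) (k : K) :
    sigmaBlock (G * H) i k = ∑ j, sigmaBlock G i j * sigmaBlock H j k := by
  ext x y
  simp [sigmaBlock, Matrix.mul_apply, Matrix.sum_apply, Fintype.sum_sigma]

theorem sigmaBlock_mul_of_ne [NonUnitalNonAssocSemiring R] [Fintype J] [∀ j, Fintype (b j)]
    (G : Matrix (Σ i, a i) (Σ j, b j) R) (H : Matrix (Σ j, b j) (Σ k, c k) R) (i : I) (j : J)
    (k : K) (h : ∀ l, l ≠ j → sigmaBlock G i l = 0 ∨ sigmaBlock H l k = 0) :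
    sigmaBlock (G * H) i k = sigmaBlock G i j * sigmaBlock H j k := by
  rw [sigmaBlock_mul]
  refine Finset.sum_eq_single j (fun l _ hl => ?_) (by simp)
  rcases h l hl with h | h <;> simp [h]

variable [DecidableEq I] [Zero R] {a' : I → Type*}

theorem sigmaBlock_blockDiagonal'_self (M : ∀ i, Matrix (a i) (a' i) R) (i : I) :
    sigmaBlock (Matrix.blockDiagonal' M) i i = M i := by
  ext x y
  exact Matrix.blockDiagonal'_apply_eq _ _ _ _

theorem sigmaBlock_blockDiagonal'_of_ne (M : ∀ i, Matrix (a i) (a' i) R) {i j : I} (h : i ≠ j) :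
    sigmaBlock (Matrix.blockDiagonal' M) i j = 0 := by
  ext x y
  exact Matrix.blockDiagonal'_apply_ne _ _ _ h

theorem eq_blockDiagonal' {G : Matrix (Σ i, a i) (Σ i, a' i) R}
    (h : ∀ i j, i ≠ j → sigmaBlock G i j = 0) :
    G = Matrix.blockDiagonal' fun i => sigmaBlock G i i := by
  ext ⟨i, x⟩ ⟨j, y⟩
  obtain rfl | hij := eq_or_ne i j
  · rw [Matrix.blockDiagonal'_apply_eq]
    rfl
  · rw [Matrix.blockDiagonal'_apply_ne _ _ _ hij]
    exact congrFun (congrFun (h i j hij) x) y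

theorem sigmaBlock_one_self {R : Type*} [Zero R] [One R] [∀ i, DecidableEq (a i)] (i : I) :
    sigmaBlock (1 : Matrix (Σ i, a i) (Σ i, a i) R) i i = 1 :=
  Matrix.submatrix_one _ sigma_mk_injective

end SigmaBlock

section Parameters

variable {F : Type*} [Field F] [ValuativeRel F] [TopologicalSpace F]
  [IsNonarchimedeanLocalField F] {n : ℕ}

/-! ### Tempered L-homomorphisms and twists -/

theorem eq_one_of_forall_mul_zpow_le {r c C : ℝ} (hr : 0 < r) (hc : 0 < c)
    (h : ∀ k : ℤ, c * r ^ k ≤ C) : r = 1 := by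
  have key {r : ℝ} (h : ∀ k : ℕ, c * r ^ k ≤ C) : r ≤ 1 := by
    by_contra! hr
    obtain ⟨k, hk⟩ := pow_unbounded_of_one_lt (C / c) hr
    rw [div_lt_iff₀ hc, mul_comm] at hk
    exact (h k).not_gt hk
  refine le_antisymm (key fun k => by simpa using h k) ?_
  exact (inv_le_one₀ hr).1 (key fun k => by simpa using h (-k))

theorem weilExponent_mul (v w : WeilGroup F) :
    weilExponent (v * w) = weilExponent v + weilExponent w := rfl

theorem weilExponent_inv (w : WeilGroup F) : weilExponent w⁻¹ = -weilExponent w := rfl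

theorem weilExponent_zpow (w : WeilGroup F) (k : ℤ) :
    weilExponent (w ^ k) = k * weilExponent w := by
  simp [weilExponent]

theorem coe_omega_ofReal (β : ℝ) (w : WeilGroup F) :
    (omega (β : ℂ) w : ℂ) = ((weilNorm w ^ β : ℝ) : ℂ) :=
  (Complex.ofReal_cpow (weilNorm_pos w).le β).symm

theorem omega_add (s t : ℂ) (w : WeilGroup F) : omega (s + t) w = omega s w * omega t w :=
  Units.ext (Complex.cpow_add _ _ (by exact_mod_cast (weilNorm_pos w).ne'))

theorem weilNorm_rpow (w : WeilGroup F) (β : ℝ) :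
    weilNorm w ^ β = ((residueCard F : ℝ) ^ β) ^ weilExponent w := by
  rw [weilNorm, ← Real.rpow_intCast, ← Real.rpow_intCast, ← Real.rpow_mul (Nat.cast_nonneg _),
    ← Real.rpow_mul (Nat.cast_nonneg _), mul_comm]

/-- Boundedness suffices because the set of values is closed under inversion, so that the inverses
are bounded too and the values stay in a compact part of `GLₙ(ℂ)`. -/
theorem LHom.isTempered_iff {φ : LHom F n} : φ.IsTempered ↔ ∃ C : ℝ, ∀ w i j,
    ‖(φ.toHom (1, w) : Matrix (Fin n) (Fin n) ℂ) i j‖ ≤ C := by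
  constructor
  · intro h
    have hc : Continuous fun g : GL (Fin n) ℂ =>
        (fun p : Fin n × Fin n => (g : Matrix (Fin n) (Fin n) ℂ) p.1 p.2) :=
      continuous_pi fun p => Units.continuous_val.matrix_elem p.1 p.2
    obtain ⟨C, hC⟩ := IsCompact.exists_bound_of_continuousOn h hc.continuousOn
    exact ⟨C, fun w i j => (norm_le_pi_norm _ (i, j)).trans (hC _ (subset_closure ⟨w, rfl⟩))⟩
  · rintro ⟨C, hC⟩
    let B : Set (Matrix (Fin n) (Fin n) ℂ) :=
      Set.univ.pi fun _ => Set.univ.pi fun _ => Metric.closedBall 0 C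
    have hB : IsCompact B :=
      isCompact_univ_pi fun _ => isCompact_univ_pi fun _ => isCompact_closedBall 0 C
    have hK := (Units.isClosedEmbedding_embedProduct
      (α := Matrix (Fin n) (Fin n) ℂ)).isCompact_preimage
      (hB.prod (MulOpposite.opHomeomorph.symm.isClosedEmbedding.isCompact_preimage hB))
    refine hK.of_isClosed_subset isClosed_closure (closure_minimal ?_ hK.isClosed)
    rintro _ ⟨w, rfl⟩
    refine ⟨fun i _ j _ => mem_closedBall_zero_iff.2 (hC w i j), fun i _ j _ => ?_⟩
    refine mem_closedBall_zero_iff.2 ((hC w⁻¹ i j).trans' (le_of_eq ?_))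
    have : φ.toHom (1, w⁻¹) = (φ.toHom (1, w))⁻¹ := by simp [← map_inv]
    rw [this]
    rfl

theorem LHom.coe_twist {n : ℕ} (φ : LHom F n) (s : ℂ) (x : SL(2, ℂ) × WeilGroup F) :
    ((φ.twist s).toHom x : Matrix (Fin n) (Fin n) ℂ) =
      (omega s x.2 : ℂ) • (φ.toHom x : Matrix (Fin n) (Fin n) ℂ) := rfl

theorem LHom.ext {φ ψ : LHom F n} (h : ∀ x, φ.toHom x = ψ.toHom x) : φ = ψ := by
  cases φ; cases ψ
  congr
  exact MonoidHom.ext h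

theorem LHom.twist_twist {n : ℕ} (φ : LHom F n) (s t : ℂ) :
    (φ.twist s).twist t = φ.twist (t + s) := by
  refine LHom.ext fun x => Units.ext ?_
  simp [LHom.coe_twist, smul_smul, omega_add]

theorem LHom.twist_zero {n : ℕ} (φ : LHom F n) : φ.twist 0 = φ := by
  refine LHom.ext fun x => Units.ext ?_
  simp [LHom.coe_twist, omega]

theorem LHom.twist_equiv {φ ψ : LHom F n} (h : φ ≈ ψ) (s : ℂ) : φ.twist s ≈ ψ.twist s := by
  obtain ⟨g, hg⟩ := h
  refine ⟨g, fun x => Units.ext ?_⟩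
  simp [LHom.coe_twist, hg]

theorem LHom.block_equiv {k : ℕ} {m : Fin k → ℕ} (hm : ∑ i, m i = n) {φ ψ : ∀ i, LHom F (m i)}
    (h : ∀ i, φ i ≈ ψ i) : LHom.block m hm φ ≈ LHom.block m hm ψ := by
  choose g hg using h
  refine ⟨blockDiag m hm g, fun x => ?_⟩
  change blockDiag m hm (fun i => (ψ i).toHom x) = _ * blockDiag m hm (fun i => (φ i).toHom x) * _
  rw [← map_inv, ← map_mul, ← map_mul]
  congr 1
  funext i
  exact hg i x

/-- There are no nonzero intertwiners between twists of tempered L-homomorphisms by different real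
exponents: `‖w‖ ^ (β - β') H = φ'(w) H φ(w)⁻¹` is bounded in `w`. -/
theorem eq_zero_of_intertwines {m m' : ℕ} {φ : LHom F m} {φ' : LHom F m'} (hφ : φ.IsTempered)
    (hφ' : φ'.IsTempered) {β β' : ℝ} (hβ : β' ≠ β) {H : Matrix (Fin m') (Fin m) ℂ}
    (h : ∀ x, H * ((φ.twist β).toHom x : Matrix (Fin m) (Fin m) ℂ) =
      ((φ'.twist β').toHom x : Matrix (Fin m') (Fin m') ℂ) * H) : H = 0 := by
  obtain ⟨C, hC⟩ := LHom.isTempered_iff.1 hφ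
  obtain ⟨C', hC'⟩ := LHom.isTempered_iff.1 hφ'
  obtain ⟨w₀, hw₀⟩ := exists_weilExponent_eq_one F
  have hq : (1 : ℝ) < residueCard F := by exact_mod_cast one_lt_residueCard F
  ext a b
  by_contra h0
  have hw (w : WeilGroup F) :
      (weilNorm w ^ (β - β') : ℝ) • H = (φ'.toHom (1, w) : Matrix (Fin m') (Fin m') ℂ) * H *
        (φ.toHom (1, w⁻¹) : Matrix (Fin m) (Fin m) ℂ) := by
    have e1 : (φ.toHom (1, w) : Matrix (Fin m) (Fin m) ℂ) * φ.toHom (1, w⁻¹) = 1 := by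
      rw [← Units.val_mul, ← map_mul]
      simp [← Prod.one_eq_mk]
    have hpos := Real.rpow_pos_of_pos (weilNorm_pos w) β'
    have e2 := congrArg (fun X => X * (φ.toHom (1, w⁻¹) : Matrix (Fin m) (Fin m) ℂ)) (h (1, w))
    simp only [LHom.coe_twist, coe_omega_ofReal, Matrix.mul_smul, Matrix.smul_mul,
      Matrix.mul_assoc, e1, Matrix.mul_one] at e2
    rw [Matrix.mul_assoc, Real.rpow_sub (weilNorm_pos w), div_eq_inv_mul, mul_smul,
      inv_smul_eq_iff₀ hpos.ne']
    exact e2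
  have hbd (k : ℤ) : ‖H a b‖ * ((residueCard F : ℝ) ^ (β - β')) ^ k ≤
      ∑ r, (∑ t, C' * ‖H t r‖) * C := by
    have e := congrFun (congrFun (hw (w₀ ^ k)) a) b
    rw [weilNorm_rpow, weilExponent_zpow, hw₀, mul_one, Matrix.smul_apply, Matrix.mul_apply] at e
    have e' := congrArg norm e
    rw [norm_smul, Real.norm_of_nonneg (by positivity), mul_comm] at e'
    rw [e']
    refine (norm_sum_le _ _).trans (Finset.sum_le_sum fun r _ => ?_)
    rw [norm_mul]
    refine mul_le_mul ?_ (hC _ _ _) (norm_nonneg _) ?_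
    · rw [Matrix.mul_apply]
      refine (norm_sum_le _ _).trans (Finset.sum_le_sum fun t _ => ?_)
      rw [norm_mul]
      exact mul_le_mul_of_nonneg_right (hC' _ _ _) (norm_nonneg _)
    · have : 0 ≤ C' := (norm_nonneg _).trans (hC' 1 a a)
      positivity
  have := eq_one_of_forall_mul_zpow_le (by positivity) (norm_pos_iff.2 h0) hbd
  have hlog := congrArg Real.log this
  rw [Real.log_rpow (by positivity), Real.log_one, mul_eq_zero, sub_eq_zero] at hlog
  exact hlog.elim (fun h => hβ h.symm) (Real.log_pos hq).ne'

/-! ### Uniqueness of the tuple -/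

/-- The bijection between the index set of the blocks and `Fin n` that is used in `blockDiag`. -/
abbrev blockEquiv {k : ℕ} {m : Fin k → ℕ} (hm : ∑ i, m i = n) : ((i : Fin k) × Fin (m i)) ≃ Fin n :=
  finSigmaFinEquiv.trans (finCongr hm)

theorem LHom.coe_block {k : ℕ} {m : Fin k → ℕ} (hm : ∑ i, m i = n) (φ : ∀ i, LHom F (m i))
    (x : SL(2, ℂ) × WeilGroup F) :
    ((LHom.block m hm φ).toHom x : Matrix (Fin n) (Fin n) ℂ) =
      (Matrix.blockDiagonal' fun i => ((φ i).toHom x : Matrix (Fin (m i)) (Fin (m i)) ℂ)).submatrix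
        (blockEquiv hm).symm (blockEquiv hm).symm := rfl

theorem sigmaBlock_intertwines {k k' : ℕ} {m : Fin k → ℕ} {m' : Fin k' → ℕ} {hm : ∑ i, m i = n}
    {hm' : ∑ i, m' i = n} {φ : ∀ i, LHom F (m i)} {φ' : ∀ i, LHom F (m' i)} {g : GL (Fin n) ℂ}
    (hg : ∀ x, (LHom.block m' hm' φ').toHom x = g * (LHom.block m hm φ).toHom x * g⁻¹)
    (i' : Fin k') (i : Fin k) (x : SL(2, ℂ) × WeilGroup F) :
    sigmaBlock ((g : Matrix (Fin n) (Fin n) ℂ).submatrix (blockEquiv hm') (blockEquiv hm)) i' i *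
        ((φ i).toHom x : Matrix (Fin (m i)) (Fin (m i)) ℂ) =
      ((φ' i').toHom x : Matrix (Fin (m' i')) (Fin (m' i')) ℂ) *
        sigmaBlock ((g : Matrix (Fin n) (Fin n) ℂ).submatrix (blockEquiv hm') (blockEquiv hm))
          i' i := by
  set G := (g : Matrix (Fin n) (Fin n) ℂ).submatrix (blockEquiv hm') (blockEquiv hm) with hG
  have h1 : G * Matrix.blockDiagonal'
        (fun i => ((φ i).toHom x : Matrix (Fin (m i)) (Fin (m i)) ℂ)) =
      Matrix.blockDiagonal'
        (fun i => ((φ' i).toHom x : Matrix (Fin (m' i)) (Fin (m' i)) ℂ)) * G := by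
    have h2 : (g : Matrix (Fin n) (Fin n) ℂ) * (LHom.block m hm φ).toHom x =
        (LHom.block m' hm' φ').toHom x * (g : Matrix (Fin n) (Fin n) ℂ) := by
      rw [← Units.val_mul, ← Units.val_mul, hg, inv_mul_cancel_right]
    have h3 := congrArg (fun X => X.submatrix (blockEquiv hm') (blockEquiv hm)) h2
    rw [← Matrix.submatrix_mul_equiv _ _ _ (blockEquiv hm) _,
      ← Matrix.submatrix_mul_equiv _ _ _ (blockEquiv hm') _] at h3
    simp only [LHom.coe_block, Matrix.submatrix_submatrix, Equiv.symm_comp_self,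
      Matrix.submatrix_id_id] at h3
    exact h3
  have h4 := congrArg (sigmaBlock · i' i) h1
  rwa [sigmaBlock_mul_of_ne _ _ _ i _ fun l hl =>
      Or.inr (sigmaBlock_blockDiagonal'_of_ne _ hl),
    sigmaBlock_mul_of_ne _ _ _ i' _ fun l hl =>
      Or.inl (sigmaBlock_blockDiagonal'_of_ne _ hl.symm),
    sigmaBlock_blockDiagonal'_self, sigmaBlock_blockDiagonal'_self] at h4

theorem sigmaBlock_eq_zero_of_ne {k k' : ℕ} {m : Fin k → ℕ} {m' : Fin k' → ℕ} {hm : ∑ i, m i = n}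
    {hm' : ∑ i, m' i = n} {φ : ∀ i, LHom F (m i)} {φ' : ∀ i, LHom F (m' i)}
    {β : Fin k → ℝ} {β' : Fin k' → ℝ}
    (hφ : ∀ i, (φ i).IsTempered) (hφ' : ∀ i, (φ' i).IsTempered) {g : GL (Fin n) ℂ}
    (hg : ∀ x, (LHom.block m' hm' fun i => (φ' i).twist (β' i)).toHom x =
      g * (LHom.block m hm fun i => (φ i).twist (β i)).toHom x * g⁻¹)
    {i' : Fin k'} {i : Fin k} (hi : β' i' ≠ β i) :
    sigmaBlock ((g : Matrix (Fin n) (Fin n) ℂ).submatrix (blockEquiv hm') (blockEquiv hm)) i' i =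
      0 :=
  eq_zero_of_intertwines (hφ i) (hφ' i') hi fun x => sigmaBlock_intertwines hg i' i x

/-- An exponent `β i` that is missing on the other side would make the columns of block `i` of the
conjugating matrix zero. -/
theorem range_subset_of_conj {k k' : ℕ} {m : Fin k → ℕ} {m' : Fin k' → ℕ} {hm : ∑ i, m i = n}
    {hm' : ∑ i, m' i = n} {φ : ∀ i, LHom F (m i)} {φ' : ∀ i, LHom F (m' i)}
    {β : Fin k → ℝ} {β' : Fin k' → ℝ} (h1 : ∀ i, 1 ≤ m i)
    (hφ : ∀ i, (φ i).IsTempered) (hφ' : ∀ i, (φ' i).IsTempered)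
    (h : (LHom.block m hm fun i => (φ i).twist (β i)) ≈
      LHom.block m' hm' fun i => (φ' i).twist (β' i)) : Set.range β ⊆ Set.range β' := by
  rintro _ ⟨i, rfl⟩
  obtain ⟨g, hg⟩ := h
  by_contra hne
  have h0 (i' : Fin k') := sigmaBlock_eq_zero_of_ne hφ hφ' hg (i' := i') (i := i)
    fun h => hne ⟨i', h⟩
  set q := blockEquiv hm ⟨i, ⟨0, h1 i⟩⟩
  have hcol (r : Fin n) : (g : Matrix (Fin n) (Fin n) ℂ) r q = 0 := by
    obtain ⟨⟨i', a⟩, rfl⟩ := (blockEquiv hm').surjective r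
    exact congrFun (congrFun (h0 i') a) ⟨0, h1 i⟩
  have hone : ((g⁻¹ * g : GL (Fin n) ℂ) : Matrix (Fin n) (Fin n) ℂ) q q = 1 := by simp
  rw [Units.val_mul, Matrix.mul_apply] at hone
  simp [hcol] at hone

theorem eq_of_range_eq {s s' : ℕ} {β : Fin (s + 1) → ℝ} {β' : Fin (s' + 1) → ℝ}
    (hβ : StrictAnti β) (hβ' : StrictAnti β') (h : Set.range β = Set.range β') : s = s' := by
  have := congrArg Set.ncard h
  rw [← Set.image_univ, ← Set.image_univ, Set.ncard_image_of_injective _ hβ.injective,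
    Set.ncard_image_of_injective _ hβ'.injective] at this
  simpa using this

theorem LHom.equiv_of_twist_equiv {φ ψ : LHom F n} {s : ℂ} (h : φ.twist s ≈ ψ.twist s) : φ ≈ ψ := by
  have := LHom.twist_equiv h (-s)
  rwa [LHom.twist_twist, LHom.twist_twist, neg_add_cancel, LHom.twist_zero, LHom.twist_zero] at this

/-- The conjugating matrix has zero blocks wherever the exponents differ, so both tuples have the
same exponents, and its diagonal blocks are invertible and conjugate the individual parameters. -/
theorem StandardTuple.eq_of_block_equiv {T T' : StandardTuple F n} {φ : ∀ i, LHom F (T.m i)}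
    {φ' : ∀ i, LHom F (T'.m i)} (hφ : ∀ i, (φ i).toLParameter = T.param i)
    (hφ' : ∀ i, (φ' i).toLParameter = T'.param i)
    (h : (LHom.block T.m T.sum_m fun i => (φ i).twist (T.β i)) ≈
      LHom.block T'.m T'.sum_m fun i => (φ' i).twist (T'.β i)) : T = T' := by
  obtain ⟨s, m, h1, hm, param, temp, β, anti⟩ := T
  obtain ⟨s', m', h1', hm', param', temp', β', anti'⟩ := T'
  dsimp only at φ φ' hφ hφ' h
  have tφ (i) : (φ i).IsTempered := by
    have := temp i
    rwa [← hφ i] at this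
  have tφ' (i) : (φ' i).IsTempered := by
    have := temp' i
    rwa [← hφ' i] at this
  have hr : Set.range β = Set.range β' := Set.Subset.antisymm
    (range_subset_of_conj h1 tφ tφ' h) (range_subset_of_conj h1' tφ' tφ (Setoid.symm h))
  obtain rfl : s = s' := eq_of_range_eq anti anti' hr
  obtain rfl : β = β' := (anti.range_inj anti').1 hr
  obtain ⟨g, hg⟩ := h
  have hg' : ∀ x, (LHom.block m hm fun i => (φ i).twist (β i)).toHom x =
      g⁻¹ * (LHom.block m' hm' fun i => (φ' i).twist (β i)).toHom x * g⁻¹⁻¹ := fun x => by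
    simp [hg, mul_assoc]
  set G := (g : Matrix (Fin n) (Fin n) ℂ).submatrix (blockEquiv hm') (blockEquiv hm) with hG
  set H := ((g⁻¹ : GL (Fin n) ℂ) : Matrix (Fin n) (Fin n) ℂ).submatrix (blockEquiv hm)
    (blockEquiv hm') with hH
  have hGz {i j} (hij : i ≠ j) : sigmaBlock G i j = 0 :=
    sigmaBlock_eq_zero_of_ne tφ tφ' hg (anti.injective.ne hij)
  have hHz {i j} (hij : i ≠ j) : sigmaBlock H i j = 0 :=
    sigmaBlock_eq_zero_of_ne tφ' tφ hg' (anti.injective.ne hij)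
  have hGH : G * H = 1 := by
    rw [hG, hH, Matrix.submatrix_mul_equiv, ← Units.val_mul, mul_inv_cancel, Units.val_one,
      Matrix.submatrix_one_equiv]
  have hHG : H * G = 1 := by
    rw [hG, hH, Matrix.submatrix_mul_equiv, ← Units.val_mul, inv_mul_cancel, Units.val_one,
      Matrix.submatrix_one_equiv]
  have hGHi (i) : sigmaBlock G i i * sigmaBlock H i i = 1 := by
    rw [← sigmaBlock_mul_of_ne G H i i i fun l hl => Or.inr (hHz hl), hGH, sigmaBlock_one_self]
  have hHGi (i) : sigmaBlock H i i * sigmaBlock G i i = 1 := by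
    rw [← sigmaBlock_mul_of_ne H G i i i fun l hl => Or.inr (hGz hl), hHG, sigmaBlock_one_self]
  -- The diagonal blocks are invertible rectangular matrices, hence square.
  obtain rfl : m = m' := funext fun i => by
    simpa using Matrix.square_of_invertible _ _ (hHGi i) (hGHi i)
  obtain rfl : param = param' := funext fun i => by
    rw [← hφ, ← hφ']
    refine Quotient.sound (LHom.equiv_of_twist_equiv (s := β i) ?_)
    refine ⟨⟨sigmaBlock G i i, sigmaBlock H i i, hGHi i, hHGi i⟩, fun x => ?_⟩
    rw [eq_mul_inv_iff_mul_eq]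
    exact Units.ext (sigmaBlock_intertwines hg i i x).symm
  rfl

/-! ### The grading of an L-homomorphism -/

theorem IsSemisimpleGL.exists_conj_diagonal {g : GL (Fin n) ℂ} (hg : IsSemisimpleGL g) :
    ∃ (P : GL (Fin n) ℂ) (d : Fin n → ℂ),
      ((P⁻¹ * g * P : GL (Fin n) ℂ) : Matrix (Fin n) (Fin n) ℂ) = Matrix.diagonal d := by
  set f := Matrix.toLin' (g : Matrix (Fin n) (Fin n) ℂ) with hf
  -- A basis is extracted from the spanning set of eigenvectors.
  let S : Set (Fin n → ℂ) := {v | ∃ c : ℂ, f v = c • v}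
  have hS : Submodule.span ℂ S = ⊤ := by
    rw [eq_top_iff, ← Module.End.IsSemisimple.iSup_eigenspace_eq_top hg]
    exact iSup_le fun c v hv => Submodule.subset_span ⟨c, Module.End.mem_eigenspace_iff.1 hv⟩
  obtain ⟨b, hbS, hspan, hli⟩ := exists_linearIndependent ℂ S
  let v₀ : Module.Basis b ℂ (Fin n → ℂ) := Module.Basis.mk hli (by simp [hspan, hS])
  let v := v₀.reindex (v₀.indexEquiv (Pi.basisFun ℂ (Fin n)))
  have hv (j) : ∃ c : ℂ, f (v j) = c • v j := by
    have : v j ∈ S := by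
      simpa [v, v₀] using hbS (Subtype.coe_prop _)
    exact this
  choose d hd using hv
  let P : GL (Fin n) ℂ := ⟨(Pi.basisFun ℂ (Fin n)).toMatrix v, v.toMatrix (Pi.basisFun ℂ (Fin n)),
    Module.Basis.toMatrix_mul_toMatrix_flip _ _, Module.Basis.toMatrix_mul_toMatrix_flip _ _⟩
  refine ⟨P, d, ?_⟩
  have h1 : (g : Matrix (Fin n) (Fin n) ℂ) * (P : Matrix (Fin n) (Fin n) ℂ) =
      P * Matrix.diagonal d := by
    ext i j
    have h2 := congrFun (hd j) i
    rw [hf, Matrix.toLin'_apply] at h2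
    rw [Matrix.mul_diagonal]
    exact h2.trans (mul_comm _ _)
  rw [mul_assoc, Units.val_mul, Units.val_mul, h1, ← Matrix.mul_assoc, ← Units.val_mul]
  simp

/-- The invertible diagonal matrices. -/
def diagonalGL : (Fin n → ℂˣ) →* GL (Fin n) ℂ :=
  (Units.map (Matrix.diagonalRingHom (Fin n) ℂ).toMonoidHom).comp
    (MulEquiv.piUnits (M := fun _ : Fin n => ℂ)).symm.toMonoidHom

theorem coe_diagonalGL (d : Fin n → ℂˣ) :
    (diagonalGL d : Matrix (Fin n) (Fin n) ℂ) = Matrix.diagonal fun i => (d i : ℂ) := rfl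

theorem exists_eq_diagonalGL {g : GL (Fin n) ℂ} {d : Fin n → ℂ}
    (h : (g : Matrix (Fin n) (Fin n) ℂ) = Matrix.diagonal d) :
    ∃ u : Fin n → ℂˣ, g = diagonalGL u := by
  have hd : IsUnit d := by
    have := g.isUnit
    rwa [h, Matrix.isUnit_diagonal] at this
  refine ⟨fun i => Units.mk0 (d i) (Pi.isUnit_iff.1 hd i).ne_zero, Units.ext ?_⟩
  rw [h, coe_diagonalGL]
  rfl

/-- In an eigenbasis of a Frobenius element `w₀`, graded by `b i = log_q |λ i|`, the values of `φ`
preserve the grading, and `φ(w)` grows like `‖w‖ ^ b i` in degree `b i`. On the inertia group the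
entry `(i, j)` of `φ(w₀ ^ k w w₀ ^ (-k))` is `(λ i / λ j) ^ k` times that of `φ(w)`, and it is
bounded in `k` because the inertia group is compact and normal. -/
theorem LHom.exists_graded (φ : LHom F n) : ∃ (P : GL (Fin n) ℂ) (b : Fin n → ℝ),
    (∀ x i j, b i ≠ b j →
      ((P⁻¹ * φ.toHom x * P : GL (Fin n) ℂ) : Matrix (Fin n) (Fin n) ℂ) i j = 0) ∧
    ∃ C : ℝ, ∀ w i j,
      ‖((P⁻¹ * φ.toHom (1, w) * P : GL (Fin n) ℂ) : Matrix (Fin n) (Fin n) ℂ) i j‖ ≤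
        C * weilNorm w ^ b i := by
  obtain ⟨w₀, hw₀⟩ := exists_weilExponent_eq_one F
  have hq : (1 : ℝ) < residueCard F := by exact_mod_cast one_lt_residueCard F
  obtain ⟨P, d, hd⟩ := (φ.semisimple w₀).exists_conj_diagonal
  obtain ⟨u, hu⟩ := exists_eq_diagonalGL hd
  let Ψ : SL(2, ℂ) × WeilGroup F →* GL (Fin n) ℂ :=
    (MulAut.conj P⁻¹).toMonoidHom.comp φ.toHom
  have hΨ (x) : P⁻¹ * φ.toHom x * P = Ψ x := by simp [Ψ]
  have hΨ₀ : Ψ (1, w₀) = diagonalGL u := by rw [← hu, ← hΨ]; rfl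
  have hΨk (k : ℤ) : Ψ (1, w₀ ^ k) = diagonalGL (u ^ k) := by
    rw [map_zpow, ← hΨ₀, ← map_zpow, Prod.pow_mk, one_zpow]
  let b : Fin n → ℝ := fun i => Real.logb (residueCard F) ‖(u i : ℂ)‖
  have hb (i) : (residueCard F : ℝ) ^ b i = ‖(u i : ℂ)‖ :=
    Real.rpow_logb (by positivity) hq.ne' (norm_pos_iff.2 (u i).ne_zero)
  have hcont : Continuous fun w : WeilGroup F => (Ψ (1, w) : Matrix (Fin n) (Fin n) ℂ) := by
    have h1 : Continuous fun w : WeilGroup F => P⁻¹ * φ.toHom (1, w) * P :=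
      (continuous_const.mul φ.continuous).mul continuous_const
    exact (Units.continuous_val.comp h1).congr fun w => by simp [← hΨ]
  obtain ⟨C, hC⟩ : ∃ C : ℝ, ∀ w : WeilGroup F, weilExponent w = 0 → ∀ i j,
      ‖(Ψ (1, w) : Matrix (Fin n) (Fin n) ℂ) i j‖ ≤ C := by
    have hc : Continuous fun w : WeilGroup F =>
        (fun p : Fin n × Fin n => (Ψ (1, w) : Matrix (Fin n) (Fin n) ℂ) p.1 p.2) :=
      continuous_pi fun p => hcont.matrix_elem p.1 p.2
    obtain ⟨C, hC⟩ := IsCompact.exists_bound_of_continuousOn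
      (isCompact_setOf_weilExponent_eq_zero F) hc.continuousOn
    exact ⟨C, fun w hw i j => (norm_le_pi_norm _ (i, j)).trans (hC w hw)⟩
  -- Conjugating an inertia element by all powers of `w₀` keeps its entries bounded by `C`.
  have hI (w : WeilGroup F) (hw : weilExponent w = 0) (i j) (hij : b i ≠ b j) :
      (Ψ (1, w) : Matrix (Fin n) (Fin n) ℂ) i j = 0 := by
    by_contra h0
    have h1 (k : ℤ) : ‖(Ψ (1, w) : Matrix (Fin n) (Fin n) ℂ) i j‖ *
        (‖(u i : ℂ)‖ / ‖(u j : ℂ)‖) ^ k ≤ C := by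
      refine (hC (w₀ ^ k * w * w₀ ^ (-k)) ?_ i j).trans' (le_of_eq ?_)
      · simp [weilExponent_mul, weilExponent_zpow, weilExponent_inv, hw]
      · have h2 : Ψ (1, w₀ ^ k * w * w₀ ^ (-k)) = Ψ (1, w₀ ^ k) * Ψ (1, w) * Ψ (1, w₀ ^ (-k)) := by
          rw [← map_mul, ← map_mul]
          simp
        rw [h2, hΨk, hΨk, Units.val_mul, Units.val_mul, coe_diagonalGL, coe_diagonalGL,
          Matrix.mul_diagonal, Matrix.diagonal_mul]
        simp [div_zpow]
        ring
    have h2 := eq_one_of_forall_mul_zpow_le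
      (div_pos (norm_pos_iff.2 (u i).ne_zero) (norm_pos_iff.2 (u j).ne_zero))
      (norm_pos_iff.2 h0) h1
    rw [div_eq_one_iff_eq (norm_ne_zero_iff.2 (u j).ne_zero)] at h2
    exact hij (congrArg (Real.logb (residueCard F)) h2)
  have hA (A : SL(2, ℂ)) (i j) (hij : b i ≠ b j) :
      (Ψ (A, 1) : Matrix (Fin n) (Fin n) ℂ) i j = 0 := by
    by_contra h0
    have h1 : Ψ (A, 1) * Ψ (1, w₀) = Ψ (1, w₀) * Ψ (A, 1) := by
      rw [← map_mul, ← map_mul]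
      simp
    have h2 := congrArg (fun g : GL (Fin n) ℂ => (g : Matrix (Fin n) (Fin n) ℂ) i j) h1
    simp only [hΨ₀, Units.val_mul, coe_diagonalGL, Matrix.mul_diagonal, Matrix.diagonal_mul] at h2
    rw [mul_comm] at h2
    refine hij ?_
    simp only [b, mul_right_cancel₀ h0 h2]
  have hdec (w : WeilGroup F) : ∃ v : WeilGroup F, weilExponent v = 0 ∧
      w = w₀ ^ weilExponent w * v :=
    ⟨w₀ ^ (-weilExponent w) * w,
      by simp [weilExponent_mul, weilExponent_zpow, weilExponent_inv, hw₀], by simp⟩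
  have hW (w : WeilGroup F) (i j) (hij : b i ≠ b j) :
      (Ψ (1, w) : Matrix (Fin n) (Fin n) ℂ) i j = 0 := by
    obtain ⟨v, hv, hw⟩ := hdec w
    have h2 : Ψ (1, w) = Ψ (1, w₀ ^ weilExponent w) * Ψ (1, v) := by
      rw [← map_mul, Prod.mk_mul_mk, one_mul, ← hw]
    rw [h2, hΨk, Units.val_mul, coe_diagonalGL, Matrix.diagonal_mul, hI v hv i j hij, mul_zero]
  refine ⟨P, b, fun x i j hij => ?_, C, fun w i j => ?_⟩
  · have h2 : Ψ x = Ψ (x.1, 1) * Ψ (1, x.2) := by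
      rw [← map_mul]
      simp
    rw [hΨ, h2, Units.val_mul, Matrix.mul_apply]
    refine Finset.sum_eq_zero fun r _ => ?_
    by_cases hir : b i = b r
    · rw [hW _ r j (hir ▸ hij), mul_zero]
    · rw [hA _ i r hir, zero_mul]
  · obtain ⟨v, hv, hw⟩ := hdec w
    have h2 : Ψ (1, w) = Ψ (1, w₀ ^ weilExponent w) * Ψ (1, v) := by
      rw [← map_mul, Prod.mk_mul_mk, one_mul, ← hw]
    rw [hΨ, h2, hΨk, Units.val_mul, coe_diagonalGL, Matrix.diagonal_mul, weilNorm_rpow, hb,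
      norm_mul, mul_comm]
    refine mul_le_mul (hC v hv i j) (le_of_eq ?_) (norm_nonneg _)
      ((norm_nonneg _).trans (hC v hv i j))
    simp

/-- The L-homomorphism `x ↦ A φ(x) B` on an invariant subspace: `B` is the inclusion of the subspace
in coordinates, `A` a left inverse, and the hypothesis `h` says that the subspace is invariant. -/
def LHom.restrict {m : ℕ} (φ : LHom F n) (A : Matrix (Fin m) (Fin n) ℂ)
    (B : Matrix (Fin n) (Fin m) ℂ) (hAB : A * B = 1)
    (h : ∀ x, (φ.toHom x : Matrix (Fin n) (Fin n) ℂ) * B =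
      B * (A * (φ.toHom x : Matrix (Fin n) (Fin n) ℂ) * B)) :
    LHom F m where
  toHom := MonoidHom.toHomUnits
    { toFun := fun x => A * (φ.toHom x : Matrix (Fin n) (Fin n) ℂ) * B
      map_one' := by simp [hAB]
      map_mul' := fun x y => by
        rw [map_mul, Units.val_mul, Matrix.mul_assoc, Matrix.mul_assoc, h y]
        simp only [Matrix.mul_assoc] }
  rational := by
    intro i j
    choose p hp using φ.rational
    refine ⟨∑ r, (∑ t, MvPolynomial.C (A i t) * p t r) * MvPolynomial.C (B r j), fun x => ?_⟩
    have hp' (t r) : (φ.toHom (x, 1) : Matrix (Fin n) (Fin n) ℂ) t r = _ := hp t r x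
    simp [MonoidHom.coe_toHomUnits, Matrix.mul_apply, hp']
  continuous := by
    have h1 : Continuous fun w : WeilGroup F =>
        A * (φ.toHom (1, w) : Matrix (Fin n) (Fin n) ℂ) * B :=
      (continuous_const.matrix_mul (Units.continuous_val.comp φ.continuous)).matrix_mul
        continuous_const
    refine Units.continuous_iff.2 ⟨h1, (h1.comp continuous_inv).congr fun w => ?_⟩
    simp [← map_inv, MonoidHom.coe_toHomUnits]
  semisimple := fun w => by
    -- A squarefree polynomial that annihilates `φ(w)` also annihilates its restriction.
    obtain ⟨p, hp, h0⟩ := (isSemisimple_iff_exists _).1 (φ.semisimple w)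
    refine (isSemisimple_iff_exists _).2 ⟨p, hp, ?_⟩
    have key (p : Polynomial ℂ) :
        Polynomial.aeval (φ.toHom (1, w) : Matrix (Fin n) (Fin n) ℂ) p * B =
          B * Polynomial.aeval (A * (φ.toHom (1, w) : Matrix (Fin n) (Fin n) ℂ) * B) p := by
      induction p using Polynomial.induction_on with
      | C a => simp [Algebra.algebraMap_eq_smul_one]
      | add p q hp hq => simp [Matrix.add_mul, Matrix.mul_add, hp, hq]
      | monomial k a ih =>
        rw [pow_succ, ← mul_assoc, map_mul, map_mul _ _ Polynomial.X, Polynomial.aeval_X,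
          Polynomial.aeval_X, Matrix.mul_assoc, h, ← Matrix.mul_assoc, ih, Matrix.mul_assoc]
    have h2 := key p
    have h0' : Polynomial.aeval (φ.toHom (1, w) : Matrix (Fin n) (Fin n) ℂ) p = 0 := h0
    rw [h0', Matrix.zero_mul] at h2
    have h3 := congrArg (A * ·) h2
    simp only [← Matrix.mul_assoc, hAB, Matrix.one_mul, Matrix.mul_zero] at h3
    rw [Matrix.mul_assoc] at h3
    exact (by simpa [Matrix.mul_assoc] using h3.symm)

/-- The values of `b` in decreasing order, and the corresponding partition of the indices. -/
theorem exists_sigma_equiv (hn : 1 ≤ n) (b : Fin n → ℝ) :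
    ∃ (s : ℕ) (m : Fin (s + 1) → ℕ) (β : Fin (s + 1) → ℝ)
      (e : ((i : Fin (s + 1)) × Fin (m i)) ≃ Fin n),
      (∀ i, 1 ≤ m i) ∧ StrictAnti β ∧ ∀ p, b (e p) = β p.1 := by
  classical
  have : Nonempty (Fin n) := ⟨⟨0, hn⟩⟩
  obtain ⟨s, hs⟩ := Nat.exists_eq_add_one.2
    (Finset.card_pos.2 (Finset.univ_nonempty.image b))
  let β : Fin (s + 1) → ℝ := fun i => (Finset.univ.image b).orderEmbOfFin hs i.rev
  have hmem (j) : ∃ i, β i = b j := by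
    have : b j ∈ Set.range ((Finset.univ.image b).orderEmbOfFin hs) := by simp
    obtain ⟨i, hi⟩ := this
    exact ⟨i.rev, by simpa [β] using hi⟩
  choose f hf using hmem
  have hβ : StrictAnti β := fun i j hij => by simpa [β] using hij
  refine ⟨s, fun i => Fintype.card {j // f j = i}, β,
    (Equiv.sigmaCongrRight fun i => (Fintype.equivFin _).symm).trans (Equiv.sigmaFiberEquiv f),
    fun i => ?_, hβ, fun p => ?_⟩
  · have h1 : β i ∈ Finset.univ.image b := Finset.orderEmbOfFin_mem _ _ _
    obtain ⟨j, -, hj⟩ := Finset.mem_image.1 h1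
    exact Fintype.card_pos_iff.2 ⟨⟨j, hβ.injective ((hf j).trans hj)⟩⟩
  · rw [← hf]
    exact congrArg β ((Fintype.equivFin {j // f j = p.1}).symm p.2).2

/-! ### Existence of the tuple -/

/-- The graded pieces of `φ`, in decreasing order of their degrees, are twists of tempered
L-homomorphisms. -/
theorem exists_block_equiv (hn : 1 ≤ n) (φ : LHom F n) :
    ∃ (T : StandardTuple F n) (ψ : ∀ i, LHom F (T.m i)), (∀ i, (ψ i).toLParameter = T.param i) ∧
      (LHom.block T.m T.sum_m fun i => (ψ i).twist (T.β i)) ≈ φ := by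
  obtain ⟨P, b, h0, C, hC⟩ := φ.exists_graded
  obtain ⟨s, m, β, e, h1, hβ, he⟩ := exists_sigma_equiv hn b
  have hm : ∑ i, m i = n := by simpa using Fintype.card_congr e
  let Ψ (x : SL(2, ℂ) × WeilGroup F) : Matrix ((i : Fin (s + 1)) × Fin (m i)) _ ℂ :=
    ((P⁻¹ * φ.toHom x * P : GL (Fin n) ℂ) : Matrix (Fin n) (Fin n) ℂ).submatrix e e
  have hΨ (x) {i j} (hij : i ≠ j) : sigmaBlock (Ψ x) i j = 0 := by
    ext a c
    refine h0 x _ _ ?_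
    rw [he, he]
    exact hβ.injective.ne hij
  let A (i) : Matrix (Fin (m i)) (Fin n) ℂ :=
    ((P⁻¹ : GL (Fin n) ℂ) : Matrix (Fin n) (Fin n) ℂ).submatrix (fun a => e ⟨i, a⟩) id
  let B (i) : Matrix (Fin n) (Fin (m i)) ℂ :=
    (P : Matrix (Fin n) (Fin n) ℂ).submatrix id (fun a => e ⟨i, a⟩)
  have hAB (i) : A i * B i = 1 := by
    have h2 : A i * B i = ((P⁻¹ * P : GL (Fin n) ℂ) : Matrix (Fin n) (Fin n) ℂ).submatrix
        (fun a => e ⟨i, a⟩) (fun a => e ⟨i, a⟩) := rfl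
    rw [h2, inv_mul_cancel, Units.val_one]
    exact Matrix.submatrix_one _ (e.injective.comp sigma_mk_injective)
  have hAφB (i) (x) : A i * (φ.toHom x : Matrix (Fin n) (Fin n) ℂ) * B i =
      sigmaBlock (Ψ x) i i := rfl
  have hinv (i) (x) : (φ.toHom x : Matrix (Fin n) (Fin n) ℂ) * B i =
      B i * (A i * (φ.toHom x : Matrix (Fin n) (Fin n) ℂ) * B i) := by
    rw [hAφB]
    have h2 : (φ.toHom x : Matrix (Fin n) (Fin n) ℂ) * P =
        P * ((P⁻¹ * φ.toHom x * P : GL (Fin n) ℂ) : Matrix (Fin n) (Fin n) ℂ) := by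
      rw [← Units.val_mul, ← Units.val_mul]
      simp [mul_assoc]
    ext r c
    have h3 := congrFun (congrFun h2 r) (e ⟨i, c⟩)
    refine h3.trans ?_
    rw [Matrix.mul_apply, Matrix.mul_apply, ← e.sum_comp, Fintype.sum_sigma]
    refine Finset.sum_eq_single i (fun j _ hj => Finset.sum_eq_zero fun a _ => ?_) (by simp)
    have := congrFun (congrFun (hΨ x hj) a) c
    exact mul_eq_zero_of_right _ this
  let χ (i) : LHom F (m i) := φ.restrict (A i) (B i) (hAB i) (hinv i)
  have hχ (i) : ((χ i).twist (-(β i : ℂ))).twist (β i) = χ i := by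
    rw [LHom.twist_twist, add_neg_cancel, LHom.twist_zero]
  have htemp (i) : ((χ i).twist (-(β i : ℂ))).IsTempered := by
    refine LHom.isTempered_iff.2 ⟨C, fun w a c => ?_⟩
    have hpos := weilNorm_pos w
    rw [LHom.coe_twist, ← Complex.ofReal_neg, coe_omega_ofReal, Matrix.smul_apply, norm_smul,
      Complex.norm_real, Real.norm_of_nonneg (by positivity)]
    have h2 := hC w (e ⟨i, a⟩) (e ⟨i, c⟩)
    rw [he] at h2
    refine (mul_le_mul_of_nonneg_left h2 (by positivity)).trans (le_of_eq ?_)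
    rw [mul_left_comm, ← Real.rpow_add hpos, neg_add_cancel, Real.rpow_zero, mul_one]
  refine ⟨⟨s, m, h1, hm, fun i => ((χ i).twist (-(β i : ℂ))).toLParameter, htemp, β, hβ⟩,
    fun i => (χ i).twist (-(β i : ℂ)), fun i => rfl, Setoid.symm ?_⟩
  simp only [hχ]
  -- The eigenbasis has to be permuted so that the blocks become consecutive.
  let σ : Fin n ≃ Fin n := (blockEquiv hm).symm.trans e
  refine ⟨⟨((P⁻¹ : GL (Fin n) ℂ) : Matrix (Fin n) (Fin n) ℂ).submatrix σ id,
    (P : Matrix (Fin n) (Fin n) ℂ).submatrix id σ, ?_, ?_⟩, fun x => Units.ext ?_⟩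
  · have h2 : ((P⁻¹ : GL (Fin n) ℂ) : Matrix (Fin n) (Fin n) ℂ).submatrix σ id *
        (P : Matrix (Fin n) (Fin n) ℂ).submatrix id σ =
        ((P⁻¹ * P : GL (Fin n) ℂ) : Matrix (Fin n) (Fin n) ℂ).submatrix σ σ := rfl
    rw [h2, inv_mul_cancel, Units.val_one, Matrix.submatrix_one_equiv]
  · rw [Matrix.submatrix_mul_equiv, ← Units.val_mul, mul_inv_cancel, Units.val_one,
      Matrix.submatrix_id_id]
  · rw [LHom.coe_block]
    have h2 : (Matrix.blockDiagonal' fun i => ((χ i).toHom x : Matrix (Fin (m i)) (Fin (m i)) ℂ)) =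
        Ψ x := (eq_blockDiagonal' fun i j hij => hΨ x hij).symm
    rw [h2]
    rfl

end Parameters

end LanglandsGL

end

theorem mainTheorem10 (F : Type*) [Field F] [ValuativeRel F] [TopologicalSpace F]
    [IsNonarchimedeanLocalField F] (n : ℕ) (hn : 1 ≤ n) :
    ∃ f : LanglandsGL.StandardTuple F n → LanglandsGL.LParameter F n,
      (∀ (T : LanglandsGL.StandardTuple F n) (φ : ∀ i, LanglandsGL.LHom F (T.m i)),
        (∀ i, (φ i).toLParameter = T.param i) →
          f T = (LanglandsGL.LHom.block T.m T.sum_m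
            fun i => (φ i).twist (T.β i : ℂ)).toLParameter) ∧
      Function.Bijective f := by
  have hout (T : LanglandsGL.StandardTuple F n) (i) :
      (T.param i).out.toLParameter = T.param i := Quotient.out_eq _
  refine ⟨fun T => (LanglandsGL.LHom.block T.m T.sum_m
    fun i => (T.param i).out.twist (T.β i : ℂ)).toLParameter, ?_, ?_, ?_⟩
  · intro T φ hφ
    refine Quotient.sound (LanglandsGL.LHom.block_equiv _ fun i =>
      LanglandsGL.LHom.twist_equiv ?_ _)
    exact Quotient.exact ((hout T i).trans (hφ i).symm)
  · intro T T' h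
    exact LanglandsGL.StandardTuple.eq_of_block_equiv (hout T) (hout T') (Quotient.exact h)
  · intro c
    obtain ⟨φ, rfl⟩ := Quotient.exists_rep c
    obtain ⟨T, ψ, hψ, h⟩ := LanglandsGL.exists_block_equiv hn φ
    refine ⟨T, (Quotient.sound ?_).trans (Quotient.sound h)⟩
    exact LanglandsGL.LHom.block_equiv _ fun i => LanglandsGL.LHom.twist_equiv
      (Quotient.exact ((hout T i).trans (hψ i).symm)) _
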